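/- Let $H\in(0,1)$ and let $B^H=\{B^H(t)\}_{t\ge 0}$ be a fractional Brownian motion of Hurst index $H$ on a probability space $(\Omega,\mathcal F,P)$, i.e. a real-valued Gaussian process with $E[B^H(t)]=0$ and $$E[B^H(t)B^H(s)]=\tfrac12\left(t^{2H}+s^{2H}-|t-s|^{2H}\right)\qquad (s,t\ge 0).$$ Then $B^H$ has a modification whose sample paths are continuous and are Hölder continuous of every order $\beta\in[0,H)$ on bounded intervals. That is, there is a process $Y=\{Y(t)\}_{t\ge0}$ on $(\Omega,\mathcal F,P)$, with each $Y(t)$ a random variable, such that $P[Y(t)=B^H(t)]=1$ for every $t\ge 0$, and for every $\omega\in\Omega$ the path $t\mapsto Y(t,\omega)$ is continuous on $[0,\infty)$ and, for every $\beta\in[0,H)$ and every $T\ge 0$, there is a finite constant $C=C(\omega,\beta,T)$ with $$|Y(t,\omega)-Y(s,\omega)|\le C\,|t-s|^{\beta}\qquad\text{for all } s,t\in[0,T]\quad(\text{with } 0^0=1).$$ -/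

import Mathlib

open MeasureTheory ProbabilityTheory
open scoped NNReal

/-- A real-valued process `B = (B t)`, `t ≥ 0`, on a probability space `(Ω, P)` is a
*fractional Brownian motion* of Hurst index `H ∈ (0, 1)` if it is a Gaussian process (all its
finite-dimensional distributions are Gaussian) with mean zero and covariance function
`E[B t * B s] = (t ^ (2H) + s ^ (2H) - |t - s| ^ (2H)) / 2`.
No path regularity is required. -/
structure IsFractionalBrownianMotion {Ω : Type*} [MeasurableSpace Ω]
    (H : ℝ) (B : ℝ≥0 → Ω → ℝ) (P : Measure Ω) : Prop where
  hurst_mem : H ∈ Set.Ioo (0 : ℝ) 1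
  isGaussianProcess : IsGaussianProcess B P
  mean_eq_zero : ∀ t : ℝ≥0, ∫ ω, B t ω ∂P = 0
  covariance_eq : ∀ t s : ℝ≥0, ∫ ω, B t ω * B s ω ∂P =
    (1 / 2) * ((t : ℝ) ^ (2 * H) + (s : ℝ) ^ (2 * H) - |(t : ℝ) - (s : ℝ)| ^ (2 * H))

/-- `Y` is a *modification* of the process `X`: each `Y t` is a (measurable) random variable, and
for every time `t` one has `P[X t = Y t] = 1`. -/
structure IsModification {Ω : Type*} [MeasurableSpace Ω]
    (Y X : ℝ≥0 → Ω → ℝ) (P : Measure Ω) : Prop where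
  measurable : ∀ t : ℝ≥0, Measurable (Y t)
  ae_eq : ∀ t : ℝ≥0, ∀ᵐ ω ∂P, X t ω = Y t ω

/-- A path `f : [0, ∞) → ℝ` is *Hölder continuous of order `β`* if for every `T` there is a constant
`C` with `|f t - f s| ≤ C * |t - s| ^ β` for all `s, t ∈ [0, T]`. -/
def HolderPath (β : ℝ≥0) (f : ℝ≥0 → ℝ) : Prop :=
  ∀ T : ℝ≥0, ∃ C : ℝ≥0, HolderOnWith C β f (Set.Icc 0 T)

open Filter Topology
open scoped ENNReal

/-! This is the Kolmogorov–Chentsov argument by dyadic chaining. An increment over length `h` is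
centred Gaussian with variance `h ^ (2H)`, so its `p`-th absolute moment is a constant times `h ^
(pH)` for every `p`. Given `γ < H`, a large `p` makes the normalised dyadic increments summable in
mean, hence almost surely `O(2 ^ (-γ n))` (`ae_isDyadicHolder`). For such a path the values at the
dyadic floors of `t` converge, and the limit is Hölder in `t` (`IsDyadicHolder.holderPath`). That
limit is `Y`; continuity in measure identifies `Y t` with `B t` almost surely. -/

/-- The largest multiple of `2⁻ⁿ` that is at most `t`. -/
noncomputable def dyadicFloor (n : ℕ) (t : ℝ≥0) : ℝ≥0 := (⌊2 ^ n * t⌋₊ : ℝ≥0) / 2 ^ n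

/-- The increments of `x` over the dyadic intervals of length `2⁻ⁿ` inside a bounded interval
are of order `2 ^ (-γ n)`. -/
def IsDyadicHolder (γ : ℝ) (x : ℝ≥0 → ℝ) : Prop :=
  ∀ N : ℕ, ∃ C : ℝ, ∀ n k : ℕ, k < N * 2 ^ n →
    |x ((k + 1 : ℕ) / 2 ^ n) - x ((k : ℕ) / 2 ^ n)| ≤ C * (((1 / 2 : ℝ) ^ γ) ^ n)

lemma dyadicFloor_le (n : ℕ) (t : ℝ≥0) : dyadicFloor n t ≤ t := by
  unfold dyadicFloor
  rw [div_le_iff₀ (by positivity), mul_comm t]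
  exact Nat.floor_le (zero_le)

lemma le_dyadicFloor_add (n : ℕ) (t : ℝ≥0) : t ≤ dyadicFloor n t + (1 / 2) ^ n := by
  have h : (2 : ℝ≥0) ^ n * t ≤ ⌊2 ^ n * t⌋₊ + 1 := (Nat.lt_floor_add_one _).le
  unfold dyadicFloor
  rw [one_div, inv_pow, ← one_div, ← add_div, le_div_iff₀ (by positivity), mul_comm t]
  exact h

lemma floor_two_pow_mul_lt {N : ℕ} {t : ℝ≥0} (ht : t < N) (n : ℕ) :
    ⌊2 ^ n * t⌋₊ < N * 2 ^ n := by
  rw [Nat.floor_lt (zero_le)]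
  push_cast
  rw [mul_comm]
  gcongr

lemma tendsto_dyadicFloor (t : ℝ≥0) : Tendsto (dyadicFloor · t) atTop (𝓝 t) := by
  have h : Tendsto (fun n : ℕ => t - (1 / 2 : ℝ≥0) ^ n) atTop (𝓝 (t - 0)) :=
    tendsto_const_nhds.sub (NNReal.tendsto_pow_atTop_nhds_zero_of_lt_one (by norm_num))
  rw [tsub_zero] at h
  exact tendsto_of_tendsto_of_tendsto_of_le_of_le h tendsto_const_nhds
    (fun n => tsub_le_iff_right.2 (le_dyadicFloor_add n t)) (fun n => dyadicFloor_le n t)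

/-! ### Deterministic chaining along dyadic points -/

section Deterministic

variable {x : ℝ≥0 → ℝ} {r C : ℝ} {N : ℕ}

/-- Halving the level `n + 1` floor index gives the level `n` one, so the two points coincide or
bound one interval of level `n + 1`. -/
lemma abs_dyadicFloor_succ_sub_le
    (hC : ∀ n k : ℕ, k < N * 2 ^ n →
      |x ((k + 1 : ℕ) / 2 ^ n) - x ((k : ℕ) / 2 ^ n)| ≤ C * r ^ n)
    {t : ℝ≥0} (ht : t < N) (n : ℕ) :
    |x (dyadicFloor (n + 1) t) - x (dyadicFloor n t)| ≤ C * r ^ (n + 1) := by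
  have hlt := floor_two_pow_mul_lt ht (n + 1)
  set b := ⌊2 ^ (n + 1) * t⌋₊ with hb
  have ha : ⌊2 ^ n * t⌋₊ = b / 2 := by
    rw [hb, ← Nat.floor_div_natCast]
    congr 1
    push_cast
    rw [pow_succ, mul_right_comm, mul_div_cancel_right₀ _ two_ne_zero]
  have hd : dyadicFloor n t = ((2 * (b / 2) : ℕ) : ℝ≥0) / 2 ^ (n + 1) := by
    unfold dyadicFloor
    rw [ha, pow_succ', Nat.cast_mul, Nat.cast_two, mul_div_mul_left _ _ two_ne_zero]
  have hd' : dyadicFloor (n + 1) t = (b : ℝ≥0) / 2 ^ (n + 1) := rfl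
  rw [hd, hd']
  have hk := hC (n + 1) (2 * (b / 2)) (by omega)
  rcases Nat.mod_two_eq_zero_or_one b with h | h
  -- The points coincide; `hk` only shows that the bound is nonnegative, as the sign of `C` is not
  -- assumed.
  · rw [show 2 * (b / 2) = b by omega] at hk ⊢
    rw [sub_self, abs_zero]
    exact (abs_nonneg _).trans hk
  · rwa [show 2 * (b / 2) + 1 = b by omega] at hk

lemma abs_dyadicFloor_sub_le
    (hC : ∀ n k : ℕ, k < N * 2 ^ n →
      |x ((k + 1 : ℕ) / 2 ^ n) - x ((k : ℕ) / 2 ^ n)| ≤ C * r ^ n)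
    {s t : ℝ≥0} (hst : s ≤ t) (ht : t < N) (n : ℕ) (h : t ≤ s + (1 / 2) ^ n) :
    |x (dyadicFloor n t) - x (dyadicFloor n s)| ≤ C * r ^ n := by
  have h1 : ⌊2 ^ n * s⌋₊ ≤ ⌊2 ^ n * t⌋₊ := Nat.floor_le_floor (by gcongr)
  have h2 : ⌊2 ^ n * t⌋₊ ≤ ⌊2 ^ n * s⌋₊ + 1 := by
    rw [← Nat.floor_add_one (zero_le)]
    refine Nat.floor_le_floor ?_
    calc (2 : ℝ≥0) ^ n * t ≤ 2 ^ n * (s + (1 / 2) ^ n) := by gcongr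
      _ = 2 ^ n * s + 1 := by rw [mul_add, ← mul_pow]; norm_num
  have hk := hC n ⌊2 ^ n * s⌋₊ (floor_two_pow_mul_lt (hst.trans_lt ht) n)
  unfold dyadicFloor
  rcases h1.eq_or_lt with h | h
  · rw [h, sub_self, abs_zero]
    exact (abs_nonneg _).trans hk
  · rwa [show ⌊2 ^ n * t⌋₊ = ⌊2 ^ n * s⌋₊ + 1 by omega]

end Deterministic

lemma half_rpow_lt_one {γ : ℝ} (hγ : 0 < γ) : (1 / 2 : ℝ) ^ γ < 1 :=
  Real.rpow_lt_one (by norm_num) (by norm_num) hγ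

lemma IsDyadicHolder.exists_tendsto {γ : ℝ} (hγ : 0 < γ) {x : ℝ≥0 → ℝ}
    (hx : IsDyadicHolder γ x) (t : ℝ≥0) :
    ∃ l, Tendsto (fun n => x (dyadicFloor n t)) atTop (𝓝 l) := by
  obtain ⟨N, hN⟩ := exists_nat_gt t
  obtain ⟨C, hC⟩ := hx N
  set r := (1 / 2 : ℝ) ^ γ
  refine cauchySeq_tendsto_of_complete
    (cauchySeq_of_le_geometric r (C * r) (half_rpow_lt_one hγ) fun n => ?_)
  rw [dist_comm, Real.dist_eq, mul_assoc, ← pow_succ']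
  exact abs_dyadicFloor_succ_sub_le hC hN n

lemma IsDyadicHolder.holderPath {γ : ℝ} (hγ : 0 < γ) {x y : ℝ≥0 → ℝ}
    (hx : IsDyadicHolder γ x)
    (hy : ∀ t, Tendsto (fun n => x (dyadicFloor n t)) atTop (𝓝 (y t)))
    {β : ℝ≥0} (hβ : β ≤ γ) : HolderPath β y := by
  intro T
  obtain ⟨N, hN⟩ := exists_nat_gt T
  obtain ⟨C, hC⟩ := hx N
  set r := (1 / 2 : ℝ) ^ γ with hrdef
  have hr : 0 < r := by positivity
  have hr1 : r < 1 := half_rpow_lt_one hγ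
  set D := C * r / (1 - r)
  have happrox (t : ℝ≥0) (ht : t < N) (n : ℕ) :
      |x (dyadicFloor n t) - y t| ≤ D * r ^ n := by
    have := dist_le_of_le_geometric_of_tendsto r (C * r) hr1 (fun n => by
      rw [dist_comm, Real.dist_eq, mul_assoc, ← pow_succ']
      exact abs_dyadicFloor_succ_sub_le hC ht n) (hy t) n
    rw [Real.dist_eq] at this
    convert! this using 1
    ring
  have hclose (n : ℕ) (s t : ℝ≥0) (hst : s ≤ t) (ht : t < N) (h : t ≤ s + (1 / 2) ^ n) :
      |y t - y s| ≤ (C + 2 * D) * r ^ n := by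
    have h1 := happrox t ht n
    have h2 := happrox s (hst.trans_lt ht) n
    have h3 := abs_dyadicFloor_sub_le hC hst ht n h
    rw [abs_le] at *
    constructor <;> linarith
  -- Level 0 floors are integers below `N`, so finitely many values of `x` bound `y` on `[0, N)`.
  obtain ⟨M, hM⟩ := ((Finset.range N).finite_toSet.image fun k : ℕ => |x k|).bddAbove
  have hbdd (t : ℝ≥0) (ht : t < N) : |y t| ≤ M + D := by
    have h1 := happrox t ht 0
    have h2 : |x (dyadicFloor 0 t)| ≤ M := by
      have hlt := floor_two_pow_mul_lt ht 0
      refine hM ⟨⌊2 ^ 0 * t⌋₊, by simpa using hlt, by simp [dyadicFloor]⟩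
    rw [abs_le] at *
    constructor <;> linarith
  -- The first entry serves `t - s ≤ 1`, with `2 ^ -(n+1) < t - s ≤ 2 ^ -n`; the second serves
  -- larger distances.
  set K : ℝ := max ((C + 2 * D) * 2 ^ γ) (2 * (M + D))
  refine ⟨K.toNNReal, ?_⟩
  have key (s t : ℝ≥0) (hst : s ≤ t) (ht : t < N) :
      |y t - y s| ≤ K.toNNReal * ((t : ℝ) - s) ^ (β : ℝ) := by
    rcases hst.eq_or_lt with rfl | hlt
    · simp only [sub_self, abs_zero]
      positivity
    have hpos : 0 < (t : ℝ) - s := sub_pos.2 (by exact_mod_cast hlt)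
    rcases le_or_gt ((t : ℝ) - s) 1 with h | h
    · obtain ⟨n, hn1, hn2⟩ := exists_nat_pow_near_of_lt_one hpos h
        (by norm_num : (0 : ℝ) < 1 / 2) (by norm_num)
      have h0 := hclose n s t hst ht (by
        rw [← NNReal.coe_le_coe]; push_cast; linarith)
      have hCD : 0 ≤ C + 2 * D := by
        have := (abs_nonneg _).trans h0
        exact nonneg_of_mul_nonneg_left this (by positivity)
      have hrn : r ^ n ≤ 2 ^ γ * ((t : ℝ) - s) ^ γ := by
        have : r ^ n = 2 ^ γ * ((1 / 2 : ℝ) ^ (n + 1)) ^ γ := by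
          rw [pow_succ, Real.mul_rpow (by positivity) (by positivity), mul_left_comm,
            ← Real.mul_rpow (by norm_num) (by norm_num), hrdef, ← Real.rpow_natCast,
            ← Real.rpow_natCast, ← Real.rpow_mul (by norm_num), ← Real.rpow_mul (by norm_num),
            mul_comm γ]
          norm_num
        rw [this]
        gcongr
      calc |y t - y s| ≤ (C + 2 * D) * r ^ n := h0
        _ ≤ (C + 2 * D) * (2 ^ γ * ((t : ℝ) - s) ^ γ) := by gcongr
        _ = ((C + 2 * D) * 2 ^ γ) * ((t : ℝ) - s) ^ γ := by ring
        _ ≤ K.toNNReal * ((t : ℝ) - s) ^ (β : ℝ) :=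
          mul_le_mul ((le_max_left _ _).trans (Real.le_coe_toNNReal K))
            (Real.rpow_le_rpow_of_exponent_ge hpos h hβ) (by positivity) (by positivity)
    · have h1 := hbdd t ht
      have h2 := hbdd s (hlt.trans ht)
      have h3 : |y t - y s| ≤ 2 * (M + D) := by
        rw [abs_le] at *
        constructor <;> linarith
      calc |y t - y s| ≤ K.toNNReal :=
            h3.trans ((le_max_right _ _).trans (Real.le_coe_toNNReal K))
        _ ≤ K.toNNReal * ((t : ℝ) - s) ^ (β : ℝ) :=
          le_mul_of_one_le_right (by positivity) (Real.one_le_rpow h.le (by positivity))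
  have hed (s t : ℝ≥0) (hst : s ≤ t) (ht : t < N) :
      edist (y t) (y s) ≤ K.toNNReal * edist t s ^ (β : ℝ) := by
    have := key s t hst ht
    rw [edist_nndist, edist_nndist, ← ENNReal.coe_rpow_of_nonneg _ β.coe_nonneg, ← ENNReal.coe_mul,
      ENNReal.coe_le_coe, ← NNReal.coe_le_coe]
    push_cast
    rwa [Real.dist_eq, NNReal.dist_eq,
      abs_of_nonneg (sub_nonneg.2 (NNReal.coe_le_coe.2 hst))]
  intro s hs t ht
  rcases le_total s t with h | h
  · rw [edist_comm (y s), edist_comm s]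
    exact hed s t h (ht.2.trans_lt hN)
  · exact hed t s h (hs.2.trans_lt hN)

/-! ### Gaussian moments -/

lemma lintegral_enorm_pow_gaussianReal (v : ℝ≥0) (p : ℕ) :
    ∫⁻ x, ‖x‖ₑ ^ p ∂gaussianReal 0 v =
      ENNReal.ofReal (√v) ^ p * ∫⁻ x, ‖x‖ₑ ^ p ∂gaussianReal 0 1 := by
  have h : gaussianReal 0 v = (gaussianReal 0 1).map (√v * ·) := by
    rw [gaussianReal_map_const_mul, mul_zero, mul_one]
    congr 1
    exact NNReal.eq (Real.sq_sqrt v.2).symm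
  rw [h, lintegral_map (by fun_prop) (by fun_prop), ← lintegral_const_mul _ (by fun_prop)]
  refine lintegral_congr fun x => ?_
  rw [enorm_mul, mul_pow, Real.enorm_of_nonneg (Real.sqrt_nonneg _)]

lemma lintegral_enorm_pow_gaussianReal_lt_top (μ : ℝ) (v : ℝ≥0) (p : ℕ) :
    ∫⁻ x, ‖x‖ₑ ^ p ∂gaussianReal μ v < ∞ := by
  have h := (memLp_id_gaussianReal (μ := μ) (v := v) p).eLpNorm_lt_top
  rcases eq_or_ne p 0 with rfl | hp
  · simp
  have := lintegral_rpow_enorm_lt_top_of_eLpNorm_lt_top (by exact_mod_cast hp)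
    (ENNReal.coe_ne_top) h
  simpa using this

/-! ### Increments of fractional Brownian motion -/

namespace IsFractionalBrownianMotion

variable {Ω : Type*} [MeasurableSpace Ω] {P : Measure Ω} {H : ℝ} {B : ℝ≥0 → Ω → ℝ}

lemma map_increment_eq_gaussianReal (hB : IsFractionalBrownianMotion H B P) (s t : ℝ≥0) :
    P.map (B t - B s) = gaussianReal 0 (|(t : ℝ) - s| ^ (2 * H)).toNNReal := by
  have hH := hB.hurst_mem
  have hG := hB.isGaussianProcess
  have hm (u : ℝ≥0) : MemLp (B u) 2 P := (hG.hasGaussianLaw_eval u).memLp_two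
  have : IsProbabilityMeasure P := hG.isProbabilityMeasure
  have hmean : P[B t - B s] = 0 := by
    have := integral_sub ((hm t).integrable one_le_two) ((hm s).integrable one_le_two)
    simp only [Pi.sub_apply, this, hB.mean_eq_zero, sub_zero]
  have hvar : Var[B t - B s; P] = |(t : ℝ) - s| ^ (2 * H) := by
    have hz (r : ℝ≥0) : ∫ ω, B r ω * B r ω ∂P = (r : ℝ) ^ (2 * H) := by
      rw [hB.covariance_eq, sub_self, abs_zero, Real.zero_rpow (by linarith [hH.1])]
      ring
    have hi (u w : ℝ≥0) : Integrable (fun ω => B u ω * B w ω) P := (hm u).integrable_mul (hm w)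
    have hi' : Integrable (fun ω => B t ω * B t ω - 2 * (B t ω * B s ω)) P :=
      (hi t t).sub ((hi t s).const_mul 2)
    rw [variance_of_integral_eq_zero ((hm t).sub (hm s)).aemeasurable hmean]
    calc ∫ ω, (B t - B s) ω ^ 2 ∂P
        = ∫ ω, (B t ω * B t ω - 2 * (B t ω * B s ω)) + B s ω * B s ω ∂P :=
          integral_congr_ae (ae_of_all _ fun ω => by simp only [Pi.sub_apply]; ring)
      _ = |(t : ℝ) - s| ^ (2 * H) := by
          rw [integral_add hi' (hi s s),
            integral_sub (hi t t) ((hi t s).const_mul 2), integral_const_mul, hz, hz,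
            hB.covariance_eq]
          ring
  rw [(hG.hasGaussianLaw_sub).map_eq_gaussianReal, hmean, hvar]

lemma lintegral_enorm_increment_pow (hB : IsFractionalBrownianMotion H B P) (s t : ℝ≥0) (p : ℕ) :
    ∫⁻ ω, ‖B t ω - B s ω‖ₑ ^ p ∂P =
      ENNReal.ofReal (|(t : ℝ) - s| ^ H) ^ p * ∫⁻ x, ‖x‖ₑ ^ p ∂gaussianReal 0 1 := by
  have hm : AEMeasurable (B t - B s) P :=
    (hB.isGaussianProcess.aemeasurable t).sub (hB.isGaussianProcess.aemeasurable s)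
  have h : √(|(t : ℝ) - s| ^ (2 * H)).toNNReal = |(t : ℝ) - s| ^ H := by
    rw [Real.coe_toNNReal _ (by positivity), mul_comm, Real.rpow_mul (abs_nonneg _),
      Real.rpow_two, Real.sqrt_sq (by positivity)]
  rw [← h, ← lintegral_enorm_pow_gaussianReal, ← hB.map_increment_eq_gaussianReal s t,
    lintegral_map' (by fun_prop) hm]
  rfl

lemma congr {B' : ℝ≥0 → Ω → ℝ} (hB : IsFractionalBrownianMotion H B P)
    (h : ∀ t, B t =ᵐ[P] B' t) : IsFractionalBrownianMotion H B' P where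
  hurst_mem := hB.hurst_mem
  isGaussianProcess := hB.isGaussianProcess.congr h
  mean_eq_zero t := by rw [← hB.mean_eq_zero t, integral_congr_ae (h t)]
  covariance_eq t s := by
    rw [← hB.covariance_eq t s]
    refine integral_congr_ae ?_
    filter_upwards [h t, h s] with ω h1 h2
    rw [h1, h2]

lemma ae_isDyadicHolder (hB : IsFractionalBrownianMotion H B P) {γ : ℝ} (hγ : γ < H) :
    ∀ᵐ ω ∂P, IsDyadicHolder γ (B · ω) := by
  obtain ⟨p, hp⟩ := exists_nat_gt (1 / (H - γ))
  have hp0 : 0 < p := by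
    have : (0 : ℝ) < p := lt_trans (by have := sub_pos.2 hγ; positivity) hp
    exact_mod_cast this
  have hpγ : 1 < (H - γ) * p := by
    rwa [div_lt_iff₀ (sub_pos.2 hγ), mul_comm] at hp
  set K := ∫⁻ x, ‖x‖ₑ ^ p ∂gaussianReal 0 1 with hK
  have hKtop : K ≠ ∞ := (lintegral_enorm_pow_gaussianReal_lt_top 0 1 p).ne
  set r : ℝ := (1 / 2 : ℝ) ^ γ with hr
  have hr0 : 0 < r := by positivity
  -- Ratio of the series of expectations: each level doubles the number of intervals, while the
  -- normalised `p`-th moment shrinks by `2 ^ (-(H - γ) p)`.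
  set q : ℝ := 2 * ((1 / 2 : ℝ) ^ H / r) ^ p with hq
  have hq1 : q < 1 := by
    have : q = (1 / 2 : ℝ) ^ ((H - γ) * p - 1) := by
      rw [hq, hr, ← Real.rpow_sub (by norm_num), ← Real.rpow_natCast,
        ← Real.rpow_mul (by norm_num), Real.rpow_sub_one (by norm_num)]
      ring
    rw [this]
    exact Real.rpow_lt_one (by norm_num) (by norm_num) (by linarith)
  have hmeas (s t : ℝ≥0) : AEMeasurable (fun ω => ‖B t ω - B s ω‖ₑ ^ p) P :=
    ((hB.isGaussianProcess.aemeasurable t).sub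
      (hB.isGaussianProcess.aemeasurable s)).enorm.pow_const p
  refine ae_all_iff.2 fun N => ?_
  let F (n : ℕ) (ω : Ω) : ℝ≥0∞ := ENNReal.ofReal (r⁻¹ ^ n) ^ p *
    ∑ k ∈ Finset.range (N * 2 ^ n), ‖B ((k + 1 : ℕ) / 2 ^ n) ω - B ((k : ℕ) / 2 ^ n) ω‖ₑ ^ p
  have hFm (n : ℕ) : AEMeasurable (F n) P :=
    (Finset.aemeasurable_fun_sum _ fun k _ => hmeas _ _).const_mul _
  have hF (n : ℕ) : ∫⁻ ω, F n ω ∂P = N * K * ENNReal.ofReal q ^ n := by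
    rw [lintegral_const_mul'' _ (Finset.aemeasurable_fun_sum _ fun k _ => hmeas _ _),
      lintegral_finsetSum' _ fun k _ => hmeas _ _]
    have h1 (k : ℕ) : ∫⁻ ω, ‖B ((k + 1 : ℕ) / 2 ^ n) ω - B ((k : ℕ) / 2 ^ n) ω‖ₑ ^ p ∂P =
        ENNReal.ofReal (((1 / 2 : ℝ) ^ H) ^ n) ^ p * K := by
      rw [hB.lintegral_enorm_increment_pow, ← hK]
      congr 3
      push_cast
      rw [← sub_div, add_sub_cancel_left, abs_of_pos (by positivity), ← one_div_pow,
        ← Real.rpow_natCast_mul (by norm_num), ← Real.rpow_mul_natCast (by norm_num), mul_comm H]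
    rw [Finset.sum_congr rfl fun k _ => h1 k, Finset.sum_const, Finset.card_range, nsmul_eq_mul]
    have h2 : ENNReal.ofReal q ^ n =
        ENNReal.ofReal (r⁻¹ ^ n) ^ p * (2 ^ n * ENNReal.ofReal (((1 / 2 : ℝ) ^ H) ^ n) ^ p) := by
      rw [show (2 : ℝ≥0∞) ^ n = ENNReal.ofReal (2 ^ n) by
          rw [ENNReal.ofReal_pow (by norm_num)]; norm_num,
        ← ENNReal.ofReal_pow (by positivity), ← ENNReal.ofReal_pow (by positivity),
        ← ENNReal.ofReal_pow (by positivity), ← ENNReal.ofReal_mul (by positivity),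
        ← ENNReal.ofReal_mul (by positivity)]
      congr 1
      rw [hq, div_eq_mul_inv, mul_pow, mul_pow, mul_pow, ← pow_mul, ← pow_mul, ← pow_mul,
        ← pow_mul, mul_comm p n]
      ring
    rw [h2]
    push_cast
    ring
  have hsum : ∫⁻ ω, ∑' n, F n ω ∂P ≠ ∞ := by
    rw [lintegral_tsum hFm]
    simp_rw [hF]
    rw [ENNReal.tsum_mul_left, ENNReal.tsum_geometric]
    refine ENNReal.mul_ne_top (ENNReal.mul_ne_top (ENNReal.natCast_ne_top N) hKtop)
      (ENNReal.inv_ne_top.2 (tsub_pos_of_lt ?_).ne')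
    rwa [ENNReal.ofReal_lt_one]
  filter_upwards [ae_lt_top' (AEMeasurable.tsum hFm) hsum] with ω hω
  set S := ∑' n, F n ω
  -- Each normalised increment, to the power `p`, is one term of the finite sum `S`.
  refine ⟨(S.toReal) ^ (1 / (p : ℝ)), fun n k hk => ?_⟩
  have h1 : ENNReal.ofReal (r⁻¹ ^ n) ^ p *
      ‖B ((k + 1 : ℕ) / 2 ^ n) ω - B ((k : ℕ) / 2 ^ n) ω‖ₑ ^ p ≤ S := by
    refine (mul_le_mul' le_rfl ?_).trans (ENNReal.le_tsum (f := (F · ω)) n)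
    exact Finset.single_le_sum
      (f := fun k : ℕ => ‖B ((k + 1 : ℕ) / 2 ^ n) ω - B ((k : ℕ) / 2 ^ n) ω‖ₑ ^ p)
      (fun _ _ => zero_le) (Finset.mem_range.2 hk)
  have h2 := ENNReal.toReal_mono hω.ne h1
  rw [← mul_pow, ENNReal.toReal_pow, ENNReal.toReal_mul, ENNReal.toReal_ofReal (by positivity),
    toReal_enorm, Real.norm_eq_abs] at h2
  have h3 := Real.rpow_le_rpow (by positivity) h2 (by positivity : 0 ≤ 1 / (p : ℝ))
  rw [one_div, Real.pow_rpow_inv_natCast (by positivity) hp0.ne', inv_pow,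
    inv_mul_le_iff₀ (by positivity)] at h3
  rw [one_div, mul_comm]
  exact h3

/-- The `L¹` distance of `B (u n)` and `B t` is a constant times `|u n - t| ^ H`. -/
lemma tendstoInMeasure (hB : IsFractionalBrownianMotion H B P) {u : ℕ → ℝ≥0} {t : ℝ≥0}
    (hu : Tendsto u atTop (𝓝 t)) : TendstoInMeasure P (fun n => B (u n)) atTop (B t) := by
  have hm (t : ℝ≥0) : AEStronglyMeasurable (B t) P :=
    (hB.isGaussianProcess.aemeasurable t).aestronglyMeasurable
  refine tendstoInMeasure_of_tendsto_eLpNorm one_ne_zero (fun n => hm _) (hm t) ?_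
  have h (n : ℕ) : eLpNorm (B (u n) - B t) 1 P =
      ENNReal.ofReal (|(u n : ℝ) - t| ^ H) * ∫⁻ x, ‖x‖ₑ ^ 1 ∂gaussianReal 0 1 := by
    have := hB.lintegral_enorm_increment_pow t (u n) 1
    rw [pow_one (ENNReal.ofReal _)] at this
    rw [eLpNorm_one_eq_lintegral_enorm, ← this]
    simp
  simp_rw [h]
  have h0 : Tendsto (fun n => |(u n : ℝ) - t| ^ H) atTop (𝓝 0) := by
    have h1 : Tendsto (fun n => |(u n : ℝ) - t|) atTop (𝓝 0) := by
      have h2 : Tendsto (fun n => (u n : ℝ)) atTop (𝓝 t) := NNReal.tendsto_coe.2 hu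
      simpa using (h2.sub_const (t : ℝ)).abs
    simpa [Real.zero_rpow hB.hurst_mem.1.ne'] using h1.rpow_const (Or.inr hB.hurst_mem.1.le)
  have h1 := ENNReal.Tendsto.mul_const (ENNReal.tendsto_ofReal h0)
    (Or.inr (lintegral_enorm_pow_gaussianReal_lt_top 0 1 1).ne)
  simpa using h1

end IsFractionalBrownianMotion

/-! ### Construction of the modification -/

theorem mainTheorem2 {Ω : Type*} [MeasurableSpace Ω] (P : Measure Ω) [IsProbabilityMeasure P]
    (H : ℝ) (B : ℝ≥0 → Ω → ℝ) (hB : IsFractionalBrownianMotion H B P) :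
    ∃ Y : ℝ≥0 → Ω → ℝ, IsModification Y B P ∧
      ∀ ω : Ω, Continuous (fun t : ℝ≥0 => Y t ω) ∧
        ∀ β : ℝ≥0, (β : ℝ) < H → HolderPath β (fun t : ℝ≥0 => Y t ω) := by
  -- Each `B t` is only a.e. measurable, whereas `Y t` must be measurable.
  let X (t : ℝ≥0) : Ω → ℝ := (hB.isGaussianProcess.aemeasurable t).mk (B t)
  have hXm (t : ℝ≥0) : Measurable (X t) := (hB.isGaussianProcess.aemeasurable t).measurable_mk
  have hBX (t : ℝ≥0) : B t =ᵐ[P] X t := (hB.isGaussianProcess.aemeasurable t).ae_eq_mk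
  have hX : IsFractionalBrownianMotion H X P := hB.congr hBX
  -- Rational exponents let one null set serve all orders below `H`.
  have hae : ∀ᵐ ω ∂P, ∀ γ : ℚ, (γ : ℝ) < H → IsDyadicHolder γ (X · ω) :=
    ae_all_iff.2 fun γ => by
      by_cases h : (γ : ℝ) < H
      · filter_upwards [hX.ae_isDyadicHolder h] with ω hω _ using hω
      · exact ae_of_all _ fun _ h' => absurd h' h
  obtain ⟨G, hG, hGm, hGsub⟩ := hae.exists_measurable_mem
  -- Zero paths off `G` make the limit exist for every `ω`.
  let Z (t : ℝ≥0) : Ω → ℝ := G.indicator (X t)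
  have hZm (t : ℝ≥0) : Measurable (Z t) := (hXm t).indicator hGm
  have hZ (ω : Ω) (γ : ℚ) (hγ : (γ : ℝ) < H) : IsDyadicHolder γ (Z · ω) := by
    by_cases hω : ω ∈ G
    · simpa [Z, hω] using hGsub ω hω γ hγ
    · exact fun N => ⟨0, fun n k _ => by simp [Z, hω]⟩
  have hlim (t : ℝ≥0) (ω : Ω) : ∃ l, Tendsto (fun n => Z (dyadicFloor n t) ω) atTop (𝓝 l) := by
    obtain ⟨γ, h0, h1⟩ := exists_rat_btwn hB.hurst_mem.1
    exact (hZ ω γ h1).exists_tendsto h0 t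
  choose Y hY using hlim
  have hYm (t : ℝ≥0) : Measurable (Y t) :=
    measurable_of_tendsto_metrizable (fun n => hZm (dyadicFloor n t))
      (tendsto_pi_nhds.2 fun ω => hY t ω)
  have hHolder (ω : Ω) (β : ℝ≥0) (hβ : (β : ℝ) < H) : HolderPath β (fun t => Y t ω) := by
    obtain ⟨γ, h0, h1⟩ := exists_rat_btwn hβ
    exact (hZ ω γ h1).holderPath (β.coe_nonneg.trans_lt h0) (fun t => hY t ω) h0.le
  refine ⟨Y, ⟨hYm, fun t => ?_⟩, fun ω => ⟨?_, hHolder ω⟩⟩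
  · have h1 : TendstoInMeasure P (fun n => X (dyadicFloor n t)) atTop (Y t) := by
      refine tendstoInMeasure_of_tendsto_ae (fun n => (hXm _).aestronglyMeasurable) ?_
      filter_upwards [hG] with ω hω
      simpa [Z, hω] using hY t ω
    filter_upwards [hBX t, tendstoInMeasure_ae_unique
      (hX.tendstoInMeasure (tendsto_dyadicFloor t)) h1] with ω h2 h3
    exact h2.trans h3
  · obtain ⟨β, h0, h1⟩ := exists_between hB.hurst_mem.1
    refine continuous_iff_continuousAt.2 fun t => ?_
    obtain ⟨C, hC⟩ := hHolder ω ⟨β, h0.le⟩ h1 (t + 1)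
    refine (hC.continuousOn h0).continuousAt ?_
    filter_upwards [Iic_mem_nhds (lt_add_one t)] with u hu using ⟨zero_le, hu⟩
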